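/- Let $\beta,\gamma,L>0$ and let $V:\mathbb R\to\mathbb R$ be continuously differentiable and $L$-periodic. Let $\mathbb X=\mathbb T\times\mathbb R$, where $\mathbb T=\mathbb R/L\mathbb Z$, with points $(q,p)$; put $$\bar\rho(q,p)=Z^{-1}e^{-\beta(p^2/2+V(q))},\qquad Z=\int_{\mathbb X}e^{-\beta(p^2/2+V(q))}\,dq\,dp,$$ $$\mathcal A=p\,\partial_q-V'(q)\,\partial_p,\quad \mathcal S=-p\,\partial_p+\beta^{-1}\partial_p^2,\quad \mathcal L_0=\mathcal A+\gamma\mathcal S,\quad \hat{\mathcal L}_0=-\mathcal A+\gamma\mathcal S,\quad a^+=-\partial_p+\beta p,\quad a^-=\partial_p .$$ Let $f_j,\phi_j$ ($j\ge 0$) be twice continuously differentiable functions on $\mathbb X$, square integrable with respect to $\bar\rho\,dq\,dp$, which solve the Poisson equations $$f_0=1,\qquad -\hat{\mathcal L}_0 f_j=a^+f_{j-1},\quad \int_{\mathbb X} f_j\bar\rho\,dq\,dp=0\quad(j\ge1),$$ $$-\mathcal L_0\phi_0=p,\quad \int_{\mathbb X}\phi_0\bar\rho\,dq\,dp=0,$$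 $$-\mathcal L_0\phi_j=a^-\phi_{j-1}-V_j,\quad \int_{\mathbb X}\phi_j\bar\rho\,dq\,dp=-\sum_{r=1}^{j}\int_{\mathbb X} f_r\phi_{j-r}\bar\rho\,dq\,dp\quad(j\ge1),$$ and define the drift coefficients $V_\ell$ and the diffusion correction coefficients $\Sigma_{n\ell},\Xi_{n\ell}$ ($1\le n\le\ell$) by $$V_\ell=\int_{\mathbb X} f_\ell\,p\,\bar\rho\,dq\,dp,\qquad \Sigma_{n\ell}=\int_{\mathbb X}p\,\phi_{\ell-n}f_n\,\bar\rho\,dq\,dp,\qquad \Xi_{n\ell}=\beta^{-1}\int_{\mathbb X}\phi_{\ell-n}\,\partial_pf_n\,\bar\rho\,dq\,dp .$$ If the potential is symmetric, $V(q)=V(-q)$ for all $q$, then $V_n=0$ for every even $n\ge 1$, and $\Sigma_{n\ell}=\Xi_{n\ell}=0$ for every odd $\ell$ and all $1\le n\le\ell$; the integrals defining these vanishing coefficients converge absolutely. -/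

import Mathlib

open MeasureTheory

noncomputable section

namespace TiltedLangevin

/-! Points of phase space are pairs `x = (q, p)`.  A function on `𝕋 × ℝ`, where `𝕋` is the
circle of length `L`, is a function on `ℝ × ℝ` which is `L`-periodic in `q`; integrals over
`𝕋 × ℝ` are taken over one period of `q`. -/

/-- One period cell `(0, L] × ℝ` of the phase space `𝕋 × ℝ`. -/
def cell (L : ℝ) : Set (ℝ × ℝ) := Set.Ioc 0 L ×ˢ Set.univ

/-- The partial derivative `∂_q g`. -/
def partialQ (g : ℝ × ℝ → ℝ) (x : ℝ × ℝ) : ℝ := deriv (fun q => g (q, x.2)) x.1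

/-- The partial derivative `∂_p g`. -/
def partialP (g : ℝ × ℝ → ℝ) (x : ℝ × ℝ) : ℝ := deriv (fun p => g (x.1, p)) x.2

/-- The unperturbed Hamiltonian `H₀(q, p) = p² / 2 + V(q)`. -/
def hamiltonian (V : ℝ → ℝ) (x : ℝ × ℝ) : ℝ := x.2 ^ 2 / 2 + V x.1

/-- The partition function `Z = ∫ exp(-β H₀) dq dp` over `𝕋 × ℝ`. -/
def partitionZ (V : ℝ → ℝ) (β L : ℝ) : ℝ :=
  ∫ x in cell L, Real.exp (-β * hamiltonian V x)

/-- The equilibrium density `ρ̄ = Z⁻¹ exp(-β H₀)`. -/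
def rhoBar (V : ℝ → ℝ) (β L : ℝ) (x : ℝ × ℝ) : ℝ :=
  Real.exp (-β * hamiltonian V x) / partitionZ V β L

/-- The equilibrium average `∫ g ρ̄ dq dp` over `𝕋 × ℝ`. -/
def avg (V : ℝ → ℝ) (β L : ℝ) (g : ℝ × ℝ → ℝ) : ℝ :=
  ∫ x in cell L, g x * rhoBar V β L x

/-- Integrability of `g ρ̄` over `𝕋 × ℝ`, i.e. `avg V β L g` is a convergent integral. -/
def AvgIntegrable (V : ℝ → ℝ) (β L : ℝ) (g : ℝ × ℝ → ℝ) : Prop :=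
  IntegrableOn (fun x => g x * rhoBar V β L x) (cell L)

/-- The operator `𝒜 = p ∂_q - V'(q) ∂_p`. -/
def opA (V : ℝ → ℝ) (g : ℝ × ℝ → ℝ) (x : ℝ × ℝ) : ℝ :=
  x.2 * partialQ g x - deriv V x.1 * partialP g x

/-- The operator `𝒮 = -p ∂_p + β⁻¹ ∂_p²`. -/
def opS (β : ℝ) (g : ℝ × ℝ → ℝ) (x : ℝ × ℝ) : ℝ :=
  -x.2 * partialP g x + β⁻¹ * partialP (partialP g) x

/-- The equilibrium generator `ℒ₀ = 𝒜 + γ 𝒮`. -/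
def genL0 (V : ℝ → ℝ) (β γ : ℝ) (g : ℝ × ℝ → ℝ) (x : ℝ × ℝ) : ℝ :=
  opA V g x + γ * opS β g x

/-- Its adjoint `ℒ̂₀ = -𝒜 + γ 𝒮` in `L²(ρ̄)`. -/
def genL0hat (V : ℝ → ℝ) (β γ : ℝ) (g : ℝ × ℝ → ℝ) (x : ℝ × ℝ) : ℝ :=
  -opA V g x + γ * opS β g x

/-- The creation operator `a⁺ = -∂_p + β p`. -/
def aPlus (β : ℝ) (g : ℝ × ℝ → ℝ) (x : ℝ × ℝ) : ℝ := -partialP g x + β * x.2 * g x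

/-- The annihilation operator `a⁻ = ∂_p`. -/
def aMinus (g : ℝ × ℝ → ℝ) (x : ℝ × ℝ) : ℝ := partialP g x

/-- The functions among which the Poisson equations are solved: twice continuously
differentiable, `L`-periodic in `q`, and in the weighted space `L²(𝕋 × ℝ; ρ̄)`. -/
structure Admissible (V : ℝ → ℝ) (β L : ℝ) (g : ℝ × ℝ → ℝ) : Prop where
  contDiff : ContDiff ℝ 2 g
  periodic : ∀ q p : ℝ, g (q + L, p) = g (q, p)
  sq_integrable : AvgIntegrable V β L (fun x => g x ^ 2)

/-- The drift coefficient `V_ℓ = ∫ f_ℓ p ρ̄ dq dp`. -/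
def driftCoeff (V : ℝ → ℝ) (β L : ℝ) (f : ℕ → ℝ × ℝ → ℝ) (l : ℕ) : ℝ :=
  avg V β L (fun x => f l x * x.2)

/-- The coefficient `Σ_{nℓ} = ∫ p φ_{ℓ-n} f_n ρ̄ dq dp`, for `n ≤ ℓ`. -/
def sigmaCoeff (V : ℝ → ℝ) (β L : ℝ) (f φ : ℕ → ℝ × ℝ → ℝ) (n l : ℕ) : ℝ :=
  avg V β L (fun x => x.2 * φ (l - n) x * f n x)

/-- The coefficient `Ξ_{nℓ} = β⁻¹ ∫ φ_{ℓ-n} ∂_p f_n ρ̄ dq dp`, for `n ≤ ℓ`. -/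
def xiCoeff (V : ℝ → ℝ) (β L : ℝ) (f φ : ℕ → ℝ × ℝ → ℝ) (n l : ℕ) : ℝ :=
  β⁻¹ * avg V β L (fun x => φ (l - n) x * partialP (f n) x)

/-- `(f_j)` and `(φ_j)` solve the two hierarchies of Poisson equations
`-ℒ̂₀ f_j = a⁺ f_{j-1}`, `-ℒ₀ φ_0 = p`, `-ℒ₀ φ_j = a⁻ φ_{j-1} - V_j`, with `f_0 = 1` and the
normalisations of the averages. -/
structure SolvesPoissonHierarchy (V : ℝ → ℝ) (β γ L : ℝ) (f φ : ℕ → ℝ × ℝ → ℝ) : Prop where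
  f_admissible : ∀ j, Admissible V β L (f j)
  f_zero : ∀ x, f 0 x = 1
  f_succ : ∀ j x, -genL0hat V β γ (f (j + 1)) x = aPlus β (f j) x
  f_mean : ∀ j, avg V β L (f (j + 1)) = 0
  φ_admissible : ∀ j, Admissible V β L (φ j)
  φ_zero : ∀ x, -genL0 V β γ (φ 0) x = x.2
  φ_zero_mean : avg V β L (φ 0) = 0
  φ_succ : ∀ j x,
    -genL0 V β γ (φ (j + 1)) x = aMinus (φ j) x - driftCoeff V β L f (j + 1)
  φ_succ_mean : ∀ j, avg V β L (φ (j + 1)) =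
    -∑ r ∈ Finset.Icc 1 (j + 1), avg V β L (fun x => f r x * φ (j + 1 - r) x)

end TiltedLangevin

end

namespace TiltedLangevin

open Filter Topology

/-! For even `V` the reflection `(q, p) ↦ (-q, -p)` preserves `ρ̄` and commutes with `𝒜` and `𝒮`,
while `a⁺`, `a⁻` and multiplication by `p` reverse parity. Hence `f_j` should have parity `(-1)^j`
and `φ_j` parity `(-1)^(j+1)`, and every coefficient claimed to vanish is the average of an odd
function.

Parity passes from source to solution by uniqueness (`parity_of_source`): for a source of parity `s
= ±1`, the difference of `g` and `s` times its reflection lies in the kernel of `±𝒜 + γ𝒮`, so it is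
a constant (`exists_eq_const_of_kernel`). That constant is `(1 - s)` times the mean of `g`, which is
zero if `s = 1` or `g` has mean zero.

The analytic content is that solutions are only assumed to be in `L²(ρ̄)`, with nothing known about
their derivatives. Testing the equation against `χ² g ρ̄`, with `χ` a momentum cutoff at scale `R`,
bounds `∂_p g` by the source up to an error `O(1/R)` (`avgIntegrable_partialP_sq`). With zero source
this gives the kernel statement. With source `a⁺ f_{n-1}` it gives `∂_p f_n ∈ L²(ρ̄)`, hence `p f_n
∈ L²(ρ̄)`; paired with `φ_{ℓ-n} ∈ L²(ρ̄)` this gives absolute convergence, so no derivative bound on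
`φ` is needed. -/

/-! ### Calculus of the partial derivatives. -/

theorem hasDerivAt_partialP {g : ℝ × ℝ → ℝ} (hg : ContDiff ℝ 1 g) (q p : ℝ) :
    HasDerivAt (fun p => g (q, p)) (partialP g (q, p)) p := by
  have hd : Differentiable ℝ g := hg.differentiable (by norm_num)
  have : DifferentiableAt ℝ (fun p => g (q, p)) p := by fun_prop
  exact this.hasDerivAt

theorem hasDerivAt_partialQ {g : ℝ × ℝ → ℝ} (hg : ContDiff ℝ 1 g) (q p : ℝ) :
    HasDerivAt (fun q => g (q, p)) (partialQ g (q, p)) q := by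
  have hd : Differentiable ℝ g := hg.differentiable (by norm_num)
  have : DifferentiableAt ℝ (fun q => g (q, p)) q := by fun_prop
  exact this.hasDerivAt

theorem partialP_eq_fderiv {g : ℝ × ℝ → ℝ} (hg : ContDiff ℝ 1 g) :
    partialP g = fun x => fderiv ℝ g x (0, 1) := by
  funext ⟨q, p⟩
  have hd : DifferentiableAt ℝ g (q, p) := hg.differentiable (by norm_num) _
  have h1 : HasDerivAt (fun p : ℝ => (q, p)) (0, 1) p :=
    (hasDerivAt_const p q).prodMk (hasDerivAt_id p)
  exact (hd.hasFDerivAt.comp_hasDerivAt p h1).deriv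

theorem partialQ_eq_fderiv {g : ℝ × ℝ → ℝ} (hg : ContDiff ℝ 1 g) :
    partialQ g = fun x => fderiv ℝ g x (1, 0) := by
  funext ⟨q, p⟩
  have hd : DifferentiableAt ℝ g (q, p) := hg.differentiable (by norm_num) _
  have h1 : HasDerivAt (fun q : ℝ => (q, p)) (1, 0) q :=
    (hasDerivAt_id q).prodMk (hasDerivAt_const q p)
  exact (hd.hasFDerivAt.comp_hasDerivAt q h1).deriv

theorem contDiff_partialP {g : ℝ × ℝ → ℝ} (hg : ContDiff ℝ 2 g) : ContDiff ℝ 1 (partialP g) := by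
  rw [partialP_eq_fderiv (hg.of_le (by norm_num))]
  exact (hg.fderiv_right (m := 1) (by norm_num)).clm_apply contDiff_const

theorem continuous_partialP {g : ℝ × ℝ → ℝ} (hg : ContDiff ℝ 1 g) : Continuous (partialP g) := by
  rw [partialP_eq_fderiv hg]
  exact (hg.continuous_fderiv (by norm_num)).clm_apply continuous_const

theorem continuous_partialQ {g : ℝ × ℝ → ℝ} (hg : ContDiff ℝ 1 g) : Continuous (partialQ g) := by
  rw [partialQ_eq_fderiv hg]
  exact (hg.continuous_fderiv (by norm_num)).clm_apply continuous_const

theorem partialP_neg_arg (g : ℝ × ℝ → ℝ) (x : ℝ × ℝ) :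
    partialP (fun y => g (-y)) x = -partialP g (-x) := by
  simpa [partialP] using deriv_comp_neg (fun p => g (-x.1, p)) x.2

theorem partialQ_neg_arg (g : ℝ × ℝ → ℝ) (x : ℝ × ℝ) :
    partialQ (fun y => g (-y)) x = -partialQ g (-x) := by
  simpa [partialQ] using deriv_comp_neg (fun q => g (q, -x.2)) x.1

theorem partialP_sub_mul {g h : ℝ × ℝ → ℝ} (hg : ContDiff ℝ 1 g) (hh : ContDiff ℝ 1 h) (s : ℝ)
    (x : ℝ × ℝ) : partialP (fun y => g y - s * h y) x = partialP g x - s * partialP h x :=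
  ((hasDerivAt_partialP hg x.1 x.2).sub ((hasDerivAt_partialP hh x.1 x.2).const_mul s)).deriv

theorem partialQ_sub_mul {g h : ℝ × ℝ → ℝ} (hg : ContDiff ℝ 1 g) (hh : ContDiff ℝ 1 h) (s : ℝ)
    (x : ℝ × ℝ) : partialQ (fun y => g y - s * h y) x = partialQ g x - s * partialQ h x :=
  ((hasDerivAt_partialQ hg x.1 x.2).sub ((hasDerivAt_partialQ hh x.1 x.2).const_mul s)).deriv

/-! ### Integration by parts on the cell, and momentum cutoffs. -/

theorem measurableSet_cell (L : ℝ) : MeasurableSet (cell L) :=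
  measurableSet_Ioc.prod MeasurableSet.univ

theorem integrableOn_cell_of_continuous {F : ℝ × ℝ → ℝ} (hF : Continuous F) {R : ℝ}
    (hR : ∀ q p, R ≤ |p| → F (q, p) = 0) (L : ℝ) : IntegrableOn F (cell L) := by
  have hK : IntegrableOn F (Set.Icc 0 L ×ˢ Set.Icc (-R) R) :=
    hF.continuousOn.integrableOn_compact (isCompact_Icc.prod isCompact_Icc)
  refine hK.of_forall_sdiff_eq_zero (measurableSet_cell L) ?_
  rintro ⟨q, p⟩ ⟨hx, hx'⟩
  refine hR q p ?_
  by_contra! hp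
  exact hx' ⟨Set.Ioc_subset_Icc_self hx.1, abs_le.1 hp.le⟩

theorem setIntegral_cell_partialP_eq_zero {G G' : ℝ × ℝ → ℝ} {R : ℝ} (L : ℝ)
    (hG : ∀ q p, HasDerivAt (fun p => G (q, p)) (G' (q, p)) p) (hG' : Continuous G')
    (hR : ∀ q p, R ≤ |p| → G (q, p) = 0) (hR' : ∀ q p, R ≤ |p| → G' (q, p) = 0) :
    ∫ x in cell L, G' x = 0 := by
  have hint := integrableOn_cell_of_continuous hG' hR' L
  have key : ∀ F : ℝ → ℝ, Continuous F → (∀ p, R ≤ |p| → F p = 0) → Integrable F := by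
    intro F hF h
    refine hF.integrable_of_hasCompactSupport
      (HasCompactSupport.intro (isCompact_Icc (a := -R) (b := R)) fun p hp => h p ?_)
    by_contra! hlt
    exact hp (abs_le.1 hlt.le)
  rw [cell, Measure.volume_eq_prod] at *
  rw [setIntegral_prod _ hint]
  simp only [Measure.restrict_univ]
  refine integral_eq_zero_of_ae (Eventually.of_forall fun q => ?_)
  exact integral_eq_zero_of_hasDerivAt_of_integrable (hG q)
    (key _ (hG'.comp (by fun_prop)) (hR' q))
    (key _ (continuous_iff_continuousAt.2 fun p => (hG q p).continuousAt) (hR q))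

theorem setIntegral_cell_partialQ_eq_zero {F F' : ℝ × ℝ → ℝ} {R L : ℝ} (hL : 0 ≤ L)
    (hF : ∀ q p, HasDerivAt (fun q => F (q, p)) (F' (q, p)) q) (hF' : Continuous F')
    (hper : ∀ p, F (L, p) = F (0, p)) (hR' : ∀ q p, R ≤ |p| → F' (q, p) = 0) :
    ∫ x in cell L, F' x = 0 := by
  have hint := integrableOn_cell_of_continuous hF' hR' L
  rw [cell, Measure.volume_eq_prod] at *
  rw [IntegrableOn, ← Measure.prod_restrict] at hint
  rw [← Measure.prod_restrict, integral_prod_symm _ hint]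
  refine integral_eq_zero_of_ae (Eventually.of_forall fun p => ?_)
  have hc : Continuous fun q => F' (q, p) := hF'.comp (by fun_prop)
  simp only [Pi.zero_apply]
  rw [← intervalIntegral.integral_of_le hL, intervalIntegral.integral_eq_sub_of_hasDerivAt
    (fun q _ => hF q p) (hc.intervalIntegrable _ _), hper, sub_self]

/-- Rescaling one fixed bump, `p ↦ b(p / R)`, gives a constant `c` independent of `R`. The decay `c
/ R` of the derivative is what removes the cutoff error in the energy estimate. -/
theorem exists_momentum_cutoff : ∃ c : ℝ, 0 < c ∧ ∀ R : ℝ, 1 ≤ R → ∃ χ χ' : ℝ → ℝ,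
    (∀ p, HasDerivAt χ (χ' p) p) ∧ Continuous χ' ∧ (∀ p, |χ p| ≤ 1) ∧
    (∀ p, |p| ≤ R → χ p = 1) ∧ (∀ p, 3 * R ≤ |p| → χ p = 0 ∧ χ' p = 0) ∧
    ∀ p, |χ' p| ≤ c / R := by
  let b : ContDiffBump (0 : ℝ) := ⟨1, 2, by norm_num, by norm_num⟩
  have hb : ContDiff ℝ 1 b := b.contDiff
  have hbc : Continuous (deriv b) := hb.continuous_deriv (by norm_num)
  -- The closed support is `|x| ≤ 2`; the radius 3 lies strictly outside it, so that the derivative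
  -- vanishes there too.
  have hsupp : ∀ x : ℝ, 3 ≤ |x| → x ∉ tsupport b := by
    intro x hx
    rw [b.tsupport_eq, Metric.mem_closedBall, dist_zero_right, Real.norm_eq_abs]
    change ¬ |x| ≤ 2
    linarith
  obtain ⟨c, hc⟩ := (b.hasCompactSupport.deriv).exists_bound_of_continuous hbc
  have hc0 : 0 ≤ c := (norm_nonneg _).trans (hc 0)
  refine ⟨c + 1, by linarith, fun R hR => ?_⟩
  have hR0 : 0 < R := by linarith
  refine ⟨fun p => b (p / R), fun p => deriv b (p / R) * (1 / R), fun p => ?_, by fun_prop,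
    fun p => ?_, fun p hp => ?_, fun p hp => ?_, fun p => ?_⟩
  · have h := (hb.differentiable (by norm_num) (p / R)).hasDerivAt
    exact HasDerivAt.comp (h₂ := ⇑b) (h := fun p => p / R) p h ((hasDerivAt_id p).div_const R)
  · rw [abs_of_nonneg b.nonneg]
    exact b.le_one
  · refine b.one_of_mem_closedBall ?_
    rw [Metric.mem_closedBall, dist_zero_right, Real.norm_eq_abs, abs_div, abs_of_pos hR0]
    change |p| / R ≤ 1
    rwa [div_le_one hR0]
  · have h3 : 3 ≤ |p / R| := by
      rw [abs_div, abs_of_pos hR0, le_div_iff₀ hR0]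
      exact hp
    have h := hsupp _ h3
    refine ⟨image_eq_zero_of_notMem_tsupport h, ?_⟩
    have : deriv b (p / R) = 0 := by
      by_contra hne
      exact h (support_deriv_subset hne)
    simp [this]
  · rw [abs_mul, abs_of_pos (by positivity : 0 < 1 / R), mul_one_div]
    have := hc (p / R)
    rw [Real.norm_eq_abs] at this
    gcongr
    linarith

theorem aecover_momentum (L : ℝ) :
    AECover (volume.restrict (cell L)) atTop fun n : ℕ => {x : ℝ × ℝ | |x.2| ≤ (n : ℝ) + 1} where
  ae_eventually_mem := by
    refine Eventually.of_forall fun x => ?_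
    obtain ⟨N, hN⟩ := exists_nat_ge |x.2|
    filter_upwards [eventually_ge_atTop N] with n hn
    have : (N : ℝ) ≤ n := by exact_mod_cast hn
    show |x.2| ≤ (n : ℝ) + 1
    linarith
  measurableSet n := measurableSet_le (by fun_prop) (by fun_prop)

/-- A nonnegative function whose integrals over the strips `|p| ≤ n + 1` of the cell are bounded
by `a / (n + 1) + b` is integrable over the cell, with integral at most `b`. -/
theorem integrableOn_cell_of_strip_bound {h : ℝ × ℝ → ℝ} {a b L : ℝ} (hc : Continuous h)
    (h0 : ∀ x, 0 ≤ h x)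
    (hb : ∀ n : ℕ, ∃ k : ℝ × ℝ → ℝ, IntegrableOn k (cell L) ∧ (∀ x, 0 ≤ k x) ∧
      (∀ x, |x.2| ≤ (n : ℝ) + 1 → h x ≤ k x) ∧ ∫ x in cell L, k x ≤ a / ((n : ℝ) + 1) + b) :
    IntegrableOn h (cell L) ∧ ∫ x in cell L, h x ≤ b := by
  have hcov := aecover_momentum L
  have hi : ∀ n : ℕ, IntegrableOn h {x : ℝ × ℝ | |x.2| ≤ (n : ℝ) + 1}
      (volume.restrict (cell L)) := by
    intro n
    obtain ⟨k, hk, -, hle, -⟩ := hb n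
    refine Integrable.mono' (hk.integrable.integrableOn) hc.aestronglyMeasurable ?_
    refine (ae_restrict_mem (hcov.measurableSet n)).mono fun x hx => ?_
    rw [Real.norm_of_nonneg (h0 x)]
    exact hle x hx
  have hbd : ∀ n : ℕ, ∫ x in {x : ℝ × ℝ | |x.2| ≤ (n : ℝ) + 1}, h x ∂(volume.restrict (cell L))
      ≤ a / ((n : ℝ) + 1) + b := by
    intro n
    obtain ⟨k, hk, hk0, hle, hkb⟩ := hb n
    refine (setIntegral_mono_on (hi n) hk.integrable.integrableOn (hcov.measurableSet n)
      fun x hx => hle x hx).trans (le_trans ?_ hkb)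
    exact setIntegral_le_integral hk (Eventually.of_forall hk0)
  have hlim : Tendsto (fun n : ℕ => a / ((n : ℝ) + 1) + b) atTop (𝓝 b) := by
    have := (tendsto_one_div_add_atTop_nhds_zero_nat (𝕜 := ℝ)).const_mul a
    simpa [div_eq_mul_inv] using this.add_const b
  have hint : IntegrableOn h (cell L) := by
    refine hcov.integrable_of_integral_bounded_of_nonneg_ae (|a| + b) hi
      (Eventually.of_forall h0) (Eventually.of_forall fun n => (hbd n).trans ?_)
    gcongr
    exact (div_le_div_of_nonneg_right (le_abs_self a) (by positivity)).trans
      (div_le_self (abs_nonneg a) (by linarith [Nat.cast_nonneg (α := ℝ) n]))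
  exact ⟨hint, le_of_tendsto_of_tendsto' (hcov.integral_tendsto_of_countably_generated hint)
    hlim hbd⟩

/-! ### The equilibrium density and its averages. -/

section Density

variable {V : ℝ → ℝ} {β L : ℝ}

theorem integrableOn_cell_exp_hamiltonian (hβ : 0 < β) (hV : Continuous V) :
    IntegrableOn (fun x => Real.exp (-β * hamiltonian V x)) (cell L) := by
  have h1 : IntegrableOn (fun q => Real.exp (-β * V q)) (Set.Ioc 0 L) :=
    (Continuous.integrableOn_Icc (by fun_prop)).mono_set Set.Ioc_subset_Icc_self
  have h2 : IntegrableOn (fun p : ℝ => Real.exp (-(β / 2) * p ^ 2)) Set.univ :=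
    (integrable_exp_neg_mul_sq (half_pos hβ)).integrableOn
  have h3 := Integrable.mul_prod h1.integrable h2.integrable
  rw [Measure.prod_restrict, ← Measure.volume_eq_prod] at h3
  refine h3.congr (Eventually.of_forall fun x => ?_)
  simp only [hamiltonian]
  rw [← Real.exp_add]
  ring_nf

theorem partitionZ_pos (hβ : 0 < β) (hL : 0 < L) (hV : Continuous V) : 0 < partitionZ V β L := by
  have : NeZero (volume.restrict (cell L)) := by
    refine ⟨fun h => ?_⟩
    rw [Measure.restrict_eq_zero, cell, Measure.volume_eq_prod, Measure.prod_prod] at h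
    simp [hL] at h
  exact integral_exp_pos (integrableOn_cell_exp_hamiltonian hβ hV)

theorem rhoBar_pos (hβ : 0 < β) (hL : 0 < L) (hV : Continuous V) (x : ℝ × ℝ) :
    0 < rhoBar V β L x :=
  div_pos (Real.exp_pos _) (partitionZ_pos hβ hL hV)

theorem continuous_rhoBar (hV : Continuous V) : Continuous (rhoBar V β L) := by
  unfold rhoBar hamiltonian
  fun_prop

theorem integrableOn_rhoBar (hβ : 0 < β) (hV : Continuous V) :
    IntegrableOn (rhoBar V β L) (cell L) :=
  (integrableOn_cell_exp_hamiltonian hβ hV).integrable.div_const _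

theorem avg_const (hβ : 0 < β) (hL : 0 < L) (hV : Continuous V) (c : ℝ) :
    avg V β L (fun _ => c) = c := by
  unfold avg rhoBar
  rw [integral_const_mul, integral_div]
  change c * (partitionZ V β L / partitionZ V β L) = c
  rw [div_self (partitionZ_pos hβ hL hV).ne', mul_one]

theorem hasDerivAt_rhoBar_momentum (q p : ℝ) :
    HasDerivAt (fun p => rhoBar V β L (q, p)) (-β * p * rhoBar V β L (q, p)) p := by
  unfold rhoBar hamiltonian
  have h : HasDerivAt (fun p : ℝ => -β * (p ^ 2 / 2 + V q)) (-β * p) p := by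
    have := (((hasDerivAt_pow 2 p).div_const 2).add_const (V q)).const_mul (-β)
    exact this.congr_deriv (by push_cast; ring)
  exact (h.exp.div_const (partitionZ V β L)).congr_deriv (by ring)

theorem hasDerivAt_rhoBar_position (hV : ContDiff ℝ 1 V) (q p : ℝ) :
    HasDerivAt (fun q => rhoBar V β L (q, p)) (-β * deriv V q * rhoBar V β L (q, p)) q := by
  unfold rhoBar hamiltonian
  have h : HasDerivAt (fun q : ℝ => -β * (p ^ 2 / 2 + V q)) (-β * deriv V q) q :=
    ((hV.differentiable (by norm_num) q).hasDerivAt.const_add (p ^ 2 / 2)).const_mul (-β)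
  exact (h.exp.div_const (partitionZ V β L)).congr_deriv (by ring)

theorem rhoBar_neg (hsymm : ∀ q, V q = V (-q)) (x : ℝ × ℝ) :
    rhoBar V β L (-x) = rhoBar V β L x := by
  simp [rhoBar, hamiltonian, ← hsymm]

theorem rhoBar_add_period (hper : Function.Periodic V L) (q p : ℝ) :
    rhoBar V β L (q + L, p) = rhoBar V β L (q, p) := by
  simp [rhoBar, hamiltonian, hper q]

theorem avgIntegrable_of_abs_le {g h : ℝ × ℝ → ℝ} (hβ : 0 < β) (hL : 0 < L) (hV : Continuous V)
    (hh : AvgIntegrable V β L h) (hg : Continuous g) (hle : ∀ x, |g x| ≤ h x) :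
    AvgIntegrable V β L g := by
  refine Integrable.mono' hh (hg.mul (continuous_rhoBar hV)).aestronglyMeasurable
    (Eventually.of_forall fun x => ?_)
  have hρ := rhoBar_pos hβ hL hV x
  rw [Real.norm_eq_abs, abs_mul, abs_of_pos hρ]
  exact mul_le_mul_of_nonneg_right (hle x) hρ.le

theorem AvgIntegrable.add {g h : ℝ × ℝ → ℝ} (hg : AvgIntegrable V β L g)
    (hh : AvgIntegrable V β L h) : AvgIntegrable V β L (fun x => g x + h x) := by
  refine (Integrable.add hg hh).congr (Eventually.of_forall fun x => ?_)
  simp [add_mul]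

theorem AvgIntegrable.const_mul {g : ℝ × ℝ → ℝ} (hg : AvgIntegrable V β L g) (c : ℝ) :
    AvgIntegrable V β L (fun x => c * g x) := by
  refine (Integrable.const_mul hg c).congr (Eventually.of_forall fun x => ?_)
  simp [mul_assoc]

theorem avg_add {g h : ℝ × ℝ → ℝ} (hg : AvgIntegrable V β L g) (hh : AvgIntegrable V β L h) :
    avg V β L (fun x => g x + h x) = avg V β L g + avg V β L h := by
  simp only [avg, add_mul]
  exact integral_add hg hh

theorem avg_const_mul (g : ℝ × ℝ → ℝ) (c : ℝ) :
    avg V β L (fun x => c * g x) = c * avg V β L g := by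
  simp only [avg, mul_assoc]
  exact integral_const_mul _ _

theorem avgIntegrable_mul_of_sq {g h : ℝ × ℝ → ℝ} (hβ : 0 < β) (hL : 0 < L) (hV : Continuous V)
    (hg : Continuous g) (hh : Continuous h) (hg2 : AvgIntegrable V β L (fun x => g x ^ 2))
    (hh2 : AvgIntegrable V β L (fun x => h x ^ 2)) :
    AvgIntegrable V β L (fun x => g x * h x) :=
  avgIntegrable_of_abs_le hβ hL hV (hg2.add hh2) (hg.mul hh) fun x => by
    rw [abs_le]
    constructor <;> nlinarith [sq_nonneg (g x - h x), sq_nonneg (g x + h x), sq_nonneg (g x),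
      sq_nonneg (h x)]

end Density

/-! ### Energy estimate and Gaussian moment bound. -/

section Estimates

variable {V : ℝ → ℝ} {β L : ℝ}

/-- The local energy identity: a solution of `-(σ 𝒜 + γ 𝒮) g = a⁺ w` is tested against `χ² g ρ̄`,
with `χ` a cutoff in the momentum, and integrated by parts. -/
theorem energy_identity {γ σ R : ℝ} {g w : ℝ × ℝ → ℝ} {χ χ' : ℝ → ℝ} (hβ : 0 < β) (hL : 0 < L)
    (hV : ContDiff ℝ 1 V) (hper : Function.Periodic V L) (hg : ContDiff ℝ 2 g)
    (hgper : ∀ q p, g (q + L, p) = g (q, p)) (hw : ContDiff ℝ 1 w)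
    (heq : ∀ x, σ * opA V g x + γ * opS β g x = -aPlus β w x)
    (hχ : ∀ p, HasDerivAt χ (χ' p) p) (hχ' : Continuous χ')
    (hR : ∀ p, R ≤ |p| → χ p = 0 ∧ χ' p = 0) :
    IntegrableOn (fun x : ℝ × ℝ => (γ / β * (partialP g x ^ 2 * χ x.2 ^ 2
        + 2 * g x * partialP g x * χ x.2 * χ' x.2) - partialP g x * w x * χ x.2 ^ 2
        - 2 * g x * w x * χ x.2 * χ' x.2
        - σ * deriv V x.1 * g x ^ 2 * χ x.2 * χ' x.2) * rhoBar V β L x) (cell L) ∧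
    ∫ x in cell L, (γ / β * (partialP g x ^ 2 * χ x.2 ^ 2
        + 2 * g x * partialP g x * χ x.2 * χ' x.2) - partialP g x * w x * χ x.2 ^ 2
        - 2 * g x * w x * χ x.2 * χ' x.2
        - σ * deriv V x.1 * g x ^ 2 * χ x.2 * χ' x.2) * rhoBar V β L x = 0 := by
  have hg1 : ContDiff ℝ 1 g := hg.of_le (by norm_num)
  have hgp := contDiff_partialP hg
  have cg : Continuous g := hg.continuous
  have cw : Continuous w := hw.continuous
  have cgp : Continuous (partialP g) := hgp.continuous
  have cgq : Continuous (partialQ g) := continuous_partialQ hg1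
  have cgpp : Continuous (partialP (partialP g)) := continuous_partialP hgp
  have cwp : Continuous (partialP w) := continuous_partialP hw
  have cV : Continuous (deriv V) := hV.continuous_deriv (by norm_num)
  have cρ : Continuous (rhoBar V β L) := continuous_rhoBar hV.continuous
  have cχ : Continuous χ := continuous_iff_continuousAt.2 fun p => (hχ p).continuousAt
  have hβ0 := hβ.ne'
  have hI : Continuous fun x : ℝ × ℝ => (γ / β * (partialP g x ^ 2 * χ x.2 ^ 2
        + 2 * g x * partialP g x * χ x.2 * χ' x.2) - partialP g x * w x * χ x.2 ^ 2
        - 2 * g x * w x * χ x.2 * χ' x.2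
        - σ * deriv V x.1 * g x ^ 2 * χ x.2 * χ' x.2) * rhoBar V β L x := by fun_prop
  refine ⟨integrableOn_cell_of_continuous hI (R := R)
    (fun q p h => by simp [(hR p h).1]) L, ?_⟩
  -- The integrand is, modulo the equation, the sum of a `q`-divergence (`e1`) and a `p`-divergence
  -- (`e2`). The terms from differentiating `ρ̄` along `𝒜` cancel between the two. Since `χ` depends
  -- on `p` alone, `𝒜` hits it only through the bounded factor `V'`, so no unbounded weight `p`
  -- multiplies `χ'`.
  have e1 := setIntegral_cell_partialQ_eq_zero (R := R) hL.le
    (F := fun x => σ / 2 * x.2 * g x ^ 2 * χ x.2 ^ 2 * rhoBar V β L x)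
    (F' := fun x => σ / 2 * x.2 * χ x.2 ^ 2 *
      (2 * g x * partialQ g x - β * deriv V x.1 * g x ^ 2) * rhoBar V β L x)
    (fun q p => by
      have := ((((hasDerivAt_partialQ hg1 q p).pow 2).const_mul (σ / 2 * p)).mul_const
        (χ p ^ 2)).mul (hasDerivAt_rhoBar_position (β := β) (L := L) hV q p)
      refine (this.congr_deriv ?_).congr_of_eventuallyEq (Eventually.of_forall fun y => ?_)
      · simp only [Pi.pow_apply]
        push_cast
        ring
      · simp only [Pi.mul_apply, Pi.pow_apply])
    (by fun_prop)
    (fun p => by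
      have h1 := hgper 0 p
      have h2 := rhoBar_add_period (β := β) hper 0 p
      rw [zero_add] at h1 h2
      simp only [h1, h2])
    (fun q p h => by simp [(hR p h).1])
  have e2 := setIntegral_cell_partialP_eq_zero (R := R) L
    (G := fun x => (-(σ / 2) * deriv V x.1 * g x ^ 2 + γ / β * g x * partialP g x - g x * w x)
      * χ x.2 ^ 2 * rhoBar V β L x)
    (G' := fun x => ((-σ * deriv V x.1 * g x * partialP g x
        + γ / β * (partialP g x ^ 2 + g x * partialP (partialP g) x)
        - (partialP g x * w x + g x * partialP w x)) * χ x.2 ^ 2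
      + (-(σ / 2) * deriv V x.1 * g x ^ 2 + γ / β * g x * partialP g x - g x * w x)
        * (2 * χ x.2 * χ' x.2 - β * x.2 * χ x.2 ^ 2)) * rhoBar V β L x)
    (fun q p => by
      have d1 := hasDerivAt_partialP hg1 q p
      have d2 := hasDerivAt_partialP hgp q p
      have d3 := hasDerivAt_partialP hw q p
      have := (((((d1.pow 2).const_mul (-(σ / 2) * deriv V q)).add
        ((d1.const_mul (γ / β)).mul d2)).sub (d1.mul d3)).mul ((hχ p).pow 2)).mul
        (hasDerivAt_rhoBar_momentum (V := V) (β := β) (L := L) q p)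
      refine (this.congr_deriv ?_).congr_of_eventuallyEq (Eventually.of_forall fun y => ?_)
      · simp only [Pi.mul_apply, Pi.pow_apply, Pi.add_apply, Pi.sub_apply]
        push_cast
        ring
      · simp only [Pi.mul_apply, Pi.pow_apply, Pi.add_apply, Pi.sub_apply])
    (by fun_prop) (fun q p h => by simp [(hR p h).1]) (fun q p h => by simp [(hR p h).1])
  rw [← add_zero (0 : ℝ)]
  nth_rewrite 1 [← e1]
  rw [← e2, ← integral_add (integrableOn_cell_of_continuous (by fun_prop) (R := R)
    (fun q p h => by simp [(hR p h).1]) L) (integrableOn_cell_of_continuous (by fun_prop) (R := R)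
    (fun q p h => by simp [(hR p h).1]) L)]
  refine integral_congr_ae (Eventually.of_forall fun x => ?_)
  have h := heq x
  simp only [opA, opS, aPlus] at h
  have h' : γ / β * partialP (partialP g) x = partialP w x - β * x.2 * w x
      - σ * (x.2 * partialQ g x - deriv V x.1 * partialP g x) + γ * x.2 * partialP g x := by
    rw [div_eq_mul_inv]
    linear_combination h
  have hb : γ / β * β = γ := div_mul_cancel₀ γ hβ0
  simp only
  linear_combination (-(g x * χ x.2 ^ 2 * rhoBar V β L x)) * h'
    + (x.2 * g x * partialP g x * χ x.2 ^ 2 * rhoBar V β L x) * hb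

end Estimates

section Estimates

variable {V : ℝ → ℝ} {β L : ℝ}

/-- Pointwise Young inequality for the integrand of `energy_identity`, with `k = γ / β`, `a = g`, `b
= ∂_p g`, `y = χ`, `z = χ'`, `v = V'`. Half of the dissipation absorbs the cross terms; what is left
on `a²` is `O(1 / R)`. -/
theorem energy_integrand_lower_bound {k A C c R σ v a b w y z M : ℝ} (hk : 0 < k) (hR : 1 ≤ R)
    (hy : |y| ≤ 1) (hz : |z| ≤ c / R) (hv : |v| ≤ M)
    (hA : A = |σ| * M * c + (4 * k + 1) * c ^ 2) (hC : C = 1 / k + 1) :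
    k / 2 * (b ^ 2 * y ^ 2) ≤ (k * (b ^ 2 * y ^ 2 + 2 * a * b * y * z) - b * w * y ^ 2
      - 2 * a * w * y * z - σ * v * a ^ 2 * y * z) + (A / R * a ^ 2 + C * w ^ 2) := by
  have hR0 : 0 < R := by linarith
  have hM : 0 ≤ M := (abs_nonneg v).trans hv
  have hy2 : y ^ 2 ≤ 1 := (sq_le_one_iff_abs_le_one y).2 hy
  have hz2 : z ^ 2 ≤ c ^ 2 / R := by
    calc z ^ 2 = |z| ^ 2 := (sq_abs z).symm
      _ ≤ (c / R) ^ 2 := by gcongr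
      _ = c ^ 2 / R / R := by ring
      _ ≤ c ^ 2 / R := div_le_self (by positivity) hR
  have hσ : σ * v * (y * z) ≤ |σ| * M * c / R := by
    calc σ * v * (y * z) ≤ |σ * v * (y * z)| := le_abs_self _
      _ = |σ| * |v| * (|y| * |z|) := by simp only [abs_mul]
      _ ≤ |σ| * M * (1 * (c / R)) := by gcongr
      _ = |σ| * M * c / R := by ring
  have hAR : A / R = |σ| * M * c / R + (4 * k + 1) * (c ^ 2 / R) := by rw [hA]; ring
  have h1 : 0 ≤ a ^ 2 * (A / R - (4 * k + 1) * z ^ 2 - σ * v * (y * z)) := by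
    refine mul_nonneg (sq_nonneg a) ?_
    have := mul_le_mul_of_nonneg_left hz2 (by positivity : 0 ≤ 4 * k + 1)
    linarith
  have h2 : 0 ≤ C * w ^ 2 * (1 - y ^ 2) := by
    rw [hC]
    exact mul_nonneg (by positivity) (by linarith)
  -- `h3` and `h4` each spend `k/4 * b² y²`. `h3` and `h5` cost `(4k + 1) a² z²`, and `h4` and `h5`
  -- cost `(1/k + 1) w² y²`, whence `A` and `C`.
  have h3 : 0 ≤ k * (b * y / 2 + 2 * (a * z)) ^ 2 := by positivity
  have h4 : 0 ≤ k * (b * y / 2 - w * y / k) ^ 2 := by positivity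
  have h4' : k * (b * y / 2 - w * y / k) ^ 2
      = k / 4 * b ^ 2 * y ^ 2 - b * w * y ^ 2 + (C - 1) * w ^ 2 * y ^ 2 := by
    rw [hC]
    field_simp
    ring
  have h5 : 0 ≤ (a * z - w * y) ^ 2 := sq_nonneg _
  linarith [h1, h2, h3, h4', h4, h5]

theorem exists_abs_deriv_le (hV : ContDiff ℝ 1 V) (L : ℝ) :
    ∃ M, ∀ x ∈ cell L, |deriv V x.1| ≤ M := by
  obtain ⟨M, hM⟩ := (isCompact_Icc (a := (0 : ℝ)) (b := L)).exists_bound_of_continuousOn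
    (hV.continuous_deriv (by norm_num)).continuousOn
  exact ⟨M, fun x hx => hM _ (Set.Ioc_subset_Icc_self hx.1)⟩

/-- The energy estimate: a solution `g ∈ L²(ρ̄)` of `-(σ 𝒜 + γ 𝒮) g = a⁺ w` with `w ∈ L²(ρ̄)` has
`∂_p g ∈ L²(ρ̄)`, with norm controlled by that of `w`. -/
theorem avgIntegrable_partialP_sq {γ σ : ℝ} {g w : ℝ × ℝ → ℝ} (hβ : 0 < β) (hγ : 0 < γ)
    (hL : 0 < L) (hV : ContDiff ℝ 1 V) (hper : Function.Periodic V L) (hg : Admissible V β L g)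
    (hw : ContDiff ℝ 1 w) (hw2 : AvgIntegrable V β L (fun x => w x ^ 2))
    (heq : ∀ x, σ * opA V g x + γ * opS β g x = -aPlus β w x) :
    AvgIntegrable V β L (fun x => partialP g x ^ 2) ∧
      avg V β L (fun x => partialP g x ^ 2) ≤
        2 / (γ / β) * (1 / (γ / β) + 1) * avg V β L (fun x => w x ^ 2) := by
  obtain ⟨c, hc, hcut⟩ := exists_momentum_cutoff
  obtain ⟨M, hM⟩ := exists_abs_deriv_le hV L
  have hk : 0 < γ / β := div_pos hγ hβ
  have cgp : Continuous (partialP g) := (contDiff_partialP hg.contDiff).continuous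
  have cρ : Continuous (rhoBar V β L) := continuous_rhoBar hV.continuous
  have hρ := rhoBar_pos hβ hL hV.continuous
  -- The contribution of `g²` goes into the part divided by `n + 1`, so it disappears in the limit
  -- and the final bound involves `w` only.
  refine integrableOn_cell_of_strip_bound (a := 2 / (γ / β) *
    ((|σ| * M * c + (4 * (γ / β) + 1) * c ^ 2) * avg V β L (fun x => g x ^ 2)))
    (by fun_prop) (fun x => mul_nonneg (sq_nonneg _) (hρ x).le) fun n => ?_
  have hR : (1 : ℝ) ≤ n + 1 := by linarith [Nat.cast_nonneg (α := ℝ) n]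
  obtain ⟨χ, χ', hχ, hχ', hχ1, hχR, hχ0, hχb⟩ := hcut _ hR
  have cχ : Continuous χ := continuous_iff_continuousAt.2 fun p => (hχ p).continuousAt
  have hint : IntegrableOn (fun x => partialP g x ^ 2 * χ x.2 ^ 2 * rhoBar V β L x) (cell L) :=
    integrableOn_cell_of_continuous (by fun_prop) (R := 3 * ((n : ℝ) + 1))
      (fun q p h => by simp [(hχ0 p h).1]) L
  refine ⟨_, hint, fun x => by have := (hρ x).le; positivity, fun x hx => by simp [hχR _ hx], ?_⟩
  obtain ⟨hE, hE0⟩ := energy_identity hβ hL hV hper hg.contDiff hg.periodic hw heq hχ hχ' hχ0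
  have hB1 := hg.sq_integrable.const_mul
    ((|σ| * M * c + (4 * (γ / β) + 1) * c ^ 2) / ((n : ℝ) + 1))
  have hB2 := hw2.const_mul (1 / (γ / β) + 1)
  have hB : IntegrableOn (fun x => ((|σ| * M * c + (4 * (γ / β) + 1) * c ^ 2) / ((n : ℝ) + 1) *
      g x ^ 2 + (1 / (γ / β) + 1) * w x ^ 2) * rhoBar V β L x) (cell L) := hB1.add hB2
  have hBval := avg_add hB1 hB2
  rw [avg_const_mul, avg_const_mul, avg] at hBval
  have hmono := setIntegral_mono_on (hint.integrable.const_mul (γ / β / 2)) (hE.integrable.add hB)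
    (measurableSet_cell L) fun x hx => by
      have := mul_le_mul_of_nonneg_right (energy_integrand_lower_bound (a := g x)
        (b := partialP g x) (w := w x) (σ := σ) hk hR (hχ1 x.2) (hχb x.2) (hM x hx) rfl rfl)
        (hρ x).le
      simp only [Pi.add_apply]
      linarith
  rw [integral_const_mul] at hmono
  simp only [Pi.add_apply] at hmono
  rw [integral_add hE hB, hE0, zero_add, hBval] at hmono
  have h := mul_le_mul_of_nonneg_left hmono (by positivity : 0 ≤ 2 / (γ / β))
  rw [← mul_assoc, show 2 / (γ / β) * (γ / β / 2) = 1 by field_simp, one_mul] at h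
  exact h.trans_eq (by ring)

/-- The Gaussian moment bound: if `g, ∂_p g ∈ L²(ρ̄)`, then `p g ∈ L²(ρ̄)`. -/
theorem avgIntegrable_momentum_mul_sq {g : ℝ × ℝ → ℝ} (hβ : 0 < β) (hL : 0 < L)
    (hV : Continuous V) (hg : ContDiff ℝ 1 g) (hg2 : AvgIntegrable V β L (fun x => g x ^ 2))
    (hgp2 : AvgIntegrable V β L (fun x => partialP g x ^ 2)) :
    AvgIntegrable V β L (fun x => (x.2 * g x) ^ 2) := by
  obtain ⟨c, hc, hcut⟩ := exists_momentum_cutoff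
  have cg : Continuous g := hg.continuous
  have cgp : Continuous (partialP g) := continuous_partialP hg
  have cρ : Continuous (rhoBar V β L) := continuous_rhoBar hV
  have hρ := rhoBar_pos hβ hL hV
  have hB1 := hg2.const_mul (1 + 4 / β * c ^ 2)
  have hB2 := hgp2.const_mul (4 / β)
  have hB : IntegrableOn (fun x => ((1 + 4 / β * c ^ 2) * g x ^ 2 + 4 / β * partialP g x ^ 2)
    * rhoBar V β L x) (cell L) := hB1.add hB2
  refine (integrableOn_cell_of_strip_bound (a := 0) (b := 2 / β * ∫ x in cell L,
    ((1 + 4 / β * c ^ 2) * g x ^ 2 + 4 / β * partialP g x ^ 2) * rhoBar V β L x) (by fun_prop)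
    (fun x => mul_nonneg (sq_nonneg _) (hρ x).le) fun n => ?_).1
  have hR : (1 : ℝ) ≤ n + 1 := by linarith [Nat.cast_nonneg (α := ℝ) n]
  obtain ⟨χ, χ', hχ, hχ', hχ1, hχR, hχ0, hχb⟩ := hcut _ hR
  have cχ : Continuous χ := continuous_iff_continuousAt.2 fun p => (hχ p).continuousAt
  have hint : IntegrableOn (fun x => (x.2 * g x) ^ 2 * χ x.2 ^ 2 * rhoBar V β L x) (cell L) :=
    integrableOn_cell_of_continuous (by fun_prop) (R := 3 * ((n : ℝ) + 1))
      (fun q p h => by simp [(hχ0 p h).1]) L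
  refine ⟨_, hint, fun x => by have := (hρ x).le; positivity, fun x hx => by simp [hχR _ hx], ?_⟩
  have hE : IntegrableOn (fun x => ((g x ^ 2 + 2 * x.2 * g x * partialP g x) * χ x.2 ^ 2
      + x.2 * g x ^ 2 * (2 * χ x.2 * χ' x.2 - β * x.2 * χ x.2 ^ 2)) * rhoBar V β L x) (cell L) :=
    integrableOn_cell_of_continuous (by fun_prop) (R := 3 * ((n : ℝ) + 1))
      (fun q p h => by simp [(hχ0 p h).1]) L
  -- Differentiating `ρ̄` in `∂_p (p g² χ² ρ̄)` produces `-β p² g² χ² ρ̄`, the quantity to be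
  -- bounded.
  have hE0 := setIntegral_cell_partialP_eq_zero (R := 3 * ((n : ℝ) + 1)) L
    (G := fun x => x.2 * g x ^ 2 * χ x.2 ^ 2 * rhoBar V β L x)
    (G' := fun x => ((g x ^ 2 + 2 * x.2 * g x * partialP g x) * χ x.2 ^ 2
      + x.2 * g x ^ 2 * (2 * χ x.2 * χ' x.2 - β * x.2 * χ x.2 ^ 2)) * rhoBar V β L x)
    (fun q p => by
      have := ((((hasDerivAt_id p).mul ((hasDerivAt_partialP hg q p).pow 2))).mul
        ((hχ p).pow 2)).mul (hasDerivAt_rhoBar_momentum (V := V) (β := β) (L := L) q p)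
      refine (this.congr_deriv ?_).congr_of_eventuallyEq (Eventually.of_forall fun y => ?_)
      · simp only [Pi.mul_apply, Pi.pow_apply, id]
        push_cast
        ring
      · simp only [Pi.mul_apply, Pi.pow_apply, id])
    (by fun_prop) (fun q p h => by simp [(hχ0 p h).1]) (fun q p h => by simp [(hχ0 p h).1])
  have hmono := integral_mono (hint.integrable.const_mul (β / 2)) (hB.integrable.sub hE)
    fun x => by
      have hy2 : χ x.2 ^ 2 ≤ 1 := (sq_le_one_iff_abs_le_one _).2 (hχ1 x.2)
      have hz2 : χ' x.2 ^ 2 ≤ c ^ 2 := by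
        rw [← sq_abs]
        exact pow_le_pow_left₀ (abs_nonneg _) ((hχb x.2).trans (div_le_self hc.le hR)) 2
      have h1 : 0 ≤ g x ^ 2 * (1 - χ x.2 ^ 2) := mul_nonneg (sq_nonneg _) (by linarith)
      have h2 : 0 ≤ 4 / β * g x ^ 2 * (c ^ 2 - χ' x.2 ^ 2) :=
        mul_nonneg (by positivity) (by linarith)
      have h3 : 0 ≤ 4 / β * partialP g x ^ 2 * (1 - χ x.2 ^ 2) :=
        mul_nonneg (by positivity) (by linarith)
      -- Young's inequality, used for `t = ∂_p g χ` and `t = g χ'`; each use absorbs `β / 4` of the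
      -- `p² g²` term, leaving `β / 2`.
      have h4 : ∀ t, 0 ≤ β / 4 * (x.2 * g x * χ x.2) ^ 2 - 2 * (x.2 * g x * χ x.2) * t
          + 4 / β * t ^ 2 := fun t => by
        have : β / 4 * (x.2 * g x * χ x.2) ^ 2 - 2 * (x.2 * g x * χ x.2) * t + 4 / β * t ^ 2
            = β * (x.2 * g x * χ x.2 / 2 - 2 * t / β) ^ 2 := by field_simp; ring
        rw [this]
        positivity
      have h5 := h4 (partialP g x * χ x.2)
      have h6 := h4 (g x * χ' x.2)
      simp only [Pi.sub_apply]
      rw [← sub_mul, ← mul_assoc]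
      exact mul_le_mul_of_nonneg_right (by linarith) (hρ x).le
  rw [integral_const_mul, integral_sub' hB hE, hE0, sub_zero] at hmono
  have h := mul_le_mul_of_nonneg_left hmono (by positivity : 0 ≤ 2 / β)
  rw [← mul_assoc, show 2 / β * (β / 2) = 1 by field_simp, one_mul] at h
  exact h.trans_eq (by ring)

end Estimates

/-! ### Uniqueness up to constants. -/

section Uniqueness

variable {V : ℝ → ℝ} {β L : ℝ}

theorem eq_zero_of_setIntegral_cell_nonpos {h : ℝ × ℝ → ℝ} (hL : 0 < L) (hc : Continuous h)
    (h0 : ∀ x, 0 ≤ h x) (hper : ∀ q p, h (q + L, p) = h (q, p)) (hint : IntegrableOn h (cell L))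
    (hle : ∫ x in cell L, h x ≤ 0) (x : ℝ × ℝ) : h x = 0 := by
  have hae : h =ᵐ[volume.restrict (cell L)] 0 :=
    (setIntegral_eq_zero_iff_of_nonneg_ae (Eventually.of_forall h0) hint).1
      (le_antisymm hle (integral_nonneg h0))
  -- The cell is not open, but this inclusion suffices for continuity to upgrade vanishing a.e. to
  -- vanishing everywhere on it; periodicity does the rest.
  have hsub : cell L ⊆ closure (interior (cell L)) := by
    rw [cell, interior_prod_eq, closure_prod_eq, interior_Ioc, interior_univ, closure_univ,
      closure_Ioo hL.ne]
    exact Set.prod_mono Set.Ioc_subset_Icc_self subset_rfl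
  have hon := Measure.eqOn_of_ae_eq hae hc.continuousOn continuousOn_const hsub
  have hp : Function.Periodic (fun q => h (q, x.2)) L := fun q => hper q x.2
  obtain ⟨y, hy, hxy⟩ := hp.exists_mem_Ioc hL x.1 0
  rw [zero_add] at hy
  have : h (x.1, x.2) = h (y, x.2) := hxy
  rw [show x = (x.1, x.2) from rfl, this]
  exact hon ⟨hy, Set.mem_univ _⟩

theorem partialP_add_period {g : ℝ × ℝ → ℝ} (hper : ∀ q p, g (q + L, p) = g (q, p)) (q p : ℝ) :
    partialP g (q + L, p) = partialP g (q, p) := by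
  simp [partialP, hper]

/-- The only functions in the kernel of `σ 𝒜 + γ 𝒮` within `L²(ρ̄)` are the constants. -/
theorem exists_eq_const_of_kernel {γ σ : ℝ} {g : ℝ × ℝ → ℝ} (hβ : 0 < β) (hγ : 0 < γ)
    (hσ : σ ≠ 0) (hL : 0 < L) (hV : ContDiff ℝ 1 V) (hper : Function.Periodic V L)
    (hg : Admissible V β L g) (heq : ∀ x, σ * opA V g x + γ * opS β g x = 0) :
    ∃ c, ∀ x, g x = c := by
  have hg1 : ContDiff ℝ 1 g := hg.contDiff.of_le (by norm_num)
  have cgp : Continuous (partialP g) := (contDiff_partialP hg.contDiff).continuous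
  have cρ : Continuous (rhoBar V β L) := continuous_rhoBar hV.continuous
  have hρ := rhoBar_pos hβ hL hV.continuous
  have hzero : AvgIntegrable V β L (fun x => (fun _ => (0 : ℝ)) x ^ 2) := by
    simp [AvgIntegrable]
  obtain ⟨hint, hle⟩ := avgIntegrable_partialP_sq (w := fun _ => 0) (σ := σ) hβ hγ hL hV hper hg
    contDiff_const hzero (fun x => by simp [heq x, aPlus, partialP])
  have hp0 : ∀ x, partialP g x = 0 := fun x => by
    have := eq_zero_of_setIntegral_cell_nonpos (h := fun x => partialP g x ^ 2 * rhoBar V β L x)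
      hL (by fun_prop) (fun x => mul_nonneg (sq_nonneg _) (hρ x).le)
      (fun q p => by rw [partialP_add_period hg.periodic, rhoBar_add_period hper]) hint
      (hle.trans_eq (by simp [avg])) x
    simpa [(hρ x).ne'] using this
  have hpp0 : ∀ x, partialP (partialP g) x = 0 := fun x => by
    rw [show partialP g = fun _ => 0 from funext hp0]
    simp [partialP]
  have hindep : ∀ q p, g (q, p) = g (q, 1) := fun q p =>
    is_const_of_deriv_eq_zero (f := fun p => g (q, p))
      (fun p => (hasDerivAt_partialP hg1 q p).differentiableAt) (fun p => hp0 (q, p)) p 1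
  -- Once `∂_p g = 0`, the equation reduces to `σ p ∂_q g = 0`; it is read at `p = 1`, where the
  -- factor `p` does not vanish.
  have hq0 : ∀ q, partialQ g (q, 1) = 0 := fun q => by
    have := heq (q, 1)
    simpa [opA, opS, hp0, hpp0, hσ] using this
  refine ⟨g (0, 1), fun x => (hindep x.1 x.2).trans ?_⟩
  exact is_const_of_deriv_eq_zero (f := fun q => g (q, 1))
    (fun q => (hasDerivAt_partialQ hg1 q 1).differentiableAt) hq0 x.1 0

end Uniqueness

/-! ### Reflection symmetry of the operators and of the averages. -/

section Parity

variable {V : ℝ → ℝ} {β L : ℝ}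

theorem deriv_neg_of_even (hsymm : ∀ q, V q = V (-q)) (q : ℝ) : deriv V (-q) = -deriv V q := by
  have := deriv_comp_neg V q
  rw [← funext hsymm] at this
  linarith

theorem partialP_partialP_neg_arg (g : ℝ × ℝ → ℝ) (x : ℝ × ℝ) :
    partialP (partialP fun y => g (-y)) x = partialP (partialP g) (-x) := by
  rw [show (partialP fun y => g (-y)) = fun y => (fun z => -partialP g z) (-y) from
    funext (partialP_neg_arg g), partialP_neg_arg fun z => -partialP g z]
  simp [partialP]

/-- Each product `p ∂_q` and `V' ∂_p` consists of two factors that change sign; evenness of `V`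
enters only to make `V'` odd. -/
theorem opA_neg_arg (hsymm : ∀ q, V q = V (-q)) (g : ℝ × ℝ → ℝ) (x : ℝ × ℝ) :
    opA V (fun y => g (-y)) x = opA V g (-x) := by
  simp [opA, partialP_neg_arg, partialQ_neg_arg, deriv_neg_of_even hsymm]

theorem opS_neg_arg (g : ℝ × ℝ → ℝ) (x : ℝ × ℝ) :
    opS β (fun y => g (-y)) x = opS β g (-x) := by
  simp [opS, partialP_neg_arg, partialP_partialP_neg_arg]

/-- The map `x ↦ -x` moves the cell, whereas `x ↦ (L, 0) - x` preserves it up to a null set. On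
functions periodic in `q` the two act identically. -/
theorem measurePreserving_reflect_cell (L : ℝ) :
    MeasurePreserving (fun x : ℝ × ℝ => ((L, 0) : ℝ × ℝ) - x) (volume.restrict (cell L))
      (volume.restrict (cell L)) := by
  have hmp : MeasurePreserving (fun x : ℝ × ℝ => ((L, 0) : ℝ × ℝ) - x) :=
    Measure.measurePreserving_sub_left volume _
  have hset : (fun x : ℝ × ℝ => ((L, 0) : ℝ × ℝ) - x) ⁻¹' (Set.Ico 0 L ×ˢ Set.univ) = cell L := by
    ext x
    simp [cell, and_comm]
  have h := hmp.restrict_preimage (measurableSet_Ico.prod MeasurableSet.univ :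
    MeasurableSet (Set.Ico 0 L ×ˢ (Set.univ : Set ℝ)))
  rw [hset] at h
  have hae : (Set.Ico 0 L ×ˢ Set.univ : Set (ℝ × ℝ)) =ᵐ[volume] cell L := by
    rw [cell, Measure.volume_eq_prod]
    exact Measure.set_prod_ae_eq Ico_ae_eq_Ioc (ae_eq_refl _)
  rwa [Measure.restrict_congr_set hae] at h

theorem measurableEmbedding_reflect (L : ℝ) :
    MeasurableEmbedding (fun x : ℝ × ℝ => ((L, 0) : ℝ × ℝ) - x) :=
  (MeasurableEquiv.subLeft ((L, 0) : ℝ × ℝ)).measurableEmbedding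

theorem reflect_eq_neg_arg {h : ℝ × ℝ → ℝ} (hper : ∀ q p, h (q + L, p) = h (q, p)) (x : ℝ × ℝ) :
    h ((L, 0) - x) = h (-x) := by
  rw [← hper (-x).1 (-x).2]
  congr 1
  ext <;> simp [sub_eq_neg_add]

theorem setIntegral_cell_neg_arg {h : ℝ × ℝ → ℝ} (hper : ∀ q p, h (q + L, p) = h (q, p)) :
    ∫ x in cell L, h (-x) = ∫ x in cell L, h x := by
  simp only [← reflect_eq_neg_arg hper]
  exact (measurePreserving_reflect_cell L).integral_comp (measurableEmbedding_reflect L) h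

theorem integrableOn_cell_neg_arg {h : ℝ × ℝ → ℝ} (hper : ∀ q p, h (q + L, p) = h (q, p))
    (hint : IntegrableOn h (cell L)) : IntegrableOn (fun x => h (-x)) (cell L) := by
  simp only [← reflect_eq_neg_arg hper]
  exact (measurePreserving_reflect_cell L).integrable_comp_of_integrable hint

theorem avg_neg_arg (hper : Function.Periodic V L) (hsymm : ∀ q, V q = V (-q)) {g : ℝ × ℝ → ℝ}
    (hg : ∀ q p, g (q + L, p) = g (q, p)) : avg V β L (fun x => g (-x)) = avg V β L g := by
  have := setIntegral_cell_neg_arg (h := fun x => g x * rhoBar V β L x) (L := L)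
    (fun q p => by rw [hg, rhoBar_add_period hper])
  simp only [rhoBar_neg hsymm] at this
  exact this

theorem avg_eq_zero_of_odd (hper : Function.Periodic V L) (hsymm : ∀ q, V q = V (-q))
    {g : ℝ × ℝ → ℝ} (hg : ∀ q p, g (q + L, p) = g (q, p)) (hodd : ∀ x, g (-x) = -g x) :
    avg V β L g = 0 := by
  have h := avg_neg_arg (β := β) hper hsymm hg
  have h2 := avg_const_mul (V := V) (β := β) (L := L) g (-1)
  simp only [neg_one_mul, ← hodd] at h2
  linarith

end Parity

/-! ### From the parity of the source to the parity of the solution. -/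

section Parity

variable {V : ℝ → ℝ} {β L : ℝ}

theorem opA_sub_mul {g h : ℝ × ℝ → ℝ} (hg : ContDiff ℝ 1 g) (hh : ContDiff ℝ 1 h) (s : ℝ)
    (x : ℝ × ℝ) : opA V (fun y => g y - s * h y) x = opA V g x - s * opA V h x := by
  rw [opA, partialP_sub_mul hg hh, partialQ_sub_mul hg hh, opA, opA]
  ring

theorem opS_sub_mul {g h : ℝ × ℝ → ℝ} (hg : ContDiff ℝ 2 g) (hh : ContDiff ℝ 2 h) (s : ℝ)
    (x : ℝ × ℝ) : opS β (fun y => g y - s * h y) x = opS β g x - s * opS β h x := by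
  have h1 := funext (partialP_sub_mul (hg.of_le (m := 1) (by norm_num))
    (hh.of_le (m := 1) (by norm_num)) s)
  rw [opS, h1, partialP_sub_mul (contDiff_partialP hg) (contDiff_partialP hh), opS, opS]
  ring

theorem partialP_parity {g : ℝ × ℝ → ℝ} {s : ℝ} (hg : ∀ x, g (-x) = s * g x) (x : ℝ × ℝ) :
    partialP g (-x) = -s * partialP g x := by
  have h1 := partialP_neg_arg g x
  rw [show (fun y => g (-y)) = fun y => s * g y from funext hg] at h1
  have h2 : partialP (fun y => s * g y) x = s * partialP g x := deriv_const_mul_field s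
  linarith

theorem avgIntegrable_of_sq {g : ℝ × ℝ → ℝ} (hβ : 0 < β) (hL : 0 < L) (hV : Continuous V)
    (hg : Continuous g) (hg2 : AvgIntegrable V β L (fun x => g x ^ 2)) :
    AvgIntegrable V β L g := by
  have h1 : AvgIntegrable V β L (fun x => (fun _ => (1 : ℝ)) x ^ 2) := by
    simpa [AvgIntegrable] using integrableOn_rhoBar hβ hV
  simpa using avgIntegrable_mul_of_sq hβ hL hV hg continuous_const hg2 h1

theorem periodic_neg_arg {g : ℝ × ℝ → ℝ} (hg : ∀ q p, g (q + L, p) = g (q, p)) (q p : ℝ) :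
    g (-(q + L, p)) = g (-(q, p)) := by
  have := hg (-(q + L)) (-p)
  rw [show -(q + L) + L = -q by ring] at this
  exact this.symm

theorem Admissible.neg_arg {g : ℝ × ℝ → ℝ} (hper : Function.Periodic V L)
    (hsymm : ∀ q, V q = V (-q)) (hg : Admissible V β L g) :
    Admissible V β L (fun x => g (-x)) where
  contDiff := hg.contDiff.comp contDiff_neg
  periodic := periodic_neg_arg hg.periodic
  sq_integrable := by
    have := integrableOn_cell_neg_arg (h := fun x => g x ^ 2 * rhoBar V β L x) (L := L)
      (fun q p => by rw [hg.periodic, rhoBar_add_period hper]) hg.sq_integrable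
    simp only [rhoBar_neg hsymm] at this
    exact this

theorem Admissible.sub_mul {g h : ℝ × ℝ → ℝ} (hβ : 0 < β) (hL : 0 < L) (hV : Continuous V)
    (hg : Admissible V β L g) (hh : Admissible V β L h) (s : ℝ) :
    Admissible V β L (fun x => g x - s * h x) where
  contDiff := hg.contDiff.sub (contDiff_const.mul hh.contDiff)
  periodic q p := by rw [hg.periodic, hh.periodic]
  sq_integrable := by
    have cg := hg.contDiff.continuous
    have ch := hh.contDiff.continuous
    refine avgIntegrable_of_abs_le hβ hL hV ((hg.sq_integrable.const_mul 2).add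
      (hh.sq_integrable.const_mul (2 * s ^ 2))) (by fun_prop) fun x => ?_
    rw [abs_of_nonneg (sq_nonneg _)]
    nlinarith [sq_nonneg (g x + s * h x)]

/-- A solution of an equation whose source has parity `s` has parity `s`, by uniqueness. -/
theorem parity_of_source {γ σ s : ℝ} {g : ℝ × ℝ → ℝ} (hβ : 0 < β) (hγ : 0 < γ)
    (hσ : σ ≠ 0) (hL : 0 < L) (hV : ContDiff ℝ 1 V) (hper : Function.Periodic V L)
    (hsymm : ∀ q, V q = V (-q)) (hg : Admissible V β L g) (hs : s ^ 2 = 1)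
    (hsource : ∀ x, σ * opA V g (-x) + γ * opS β g (-x) = s * (σ * opA V g x + γ * opS β g x))
    (hmean : s = 1 ∨ avg V β L g = 0) (x : ℝ × ℝ) : g (-x) = s * g x := by
  have hn := hg.neg_arg hper hsymm
  have hd := hg.sub_mul hβ hL hV.continuous hn s
  obtain ⟨c, hc⟩ := exists_eq_const_of_kernel (σ := σ) (γ := γ) hβ hγ hσ hL hV hper hd fun x => by
    rw [opA_sub_mul (hg.contDiff.of_le (by norm_num)) (hn.contDiff.of_le (by norm_num)),
      opS_sub_mul hg.contDiff hn.contDiff, opA_neg_arg hsymm, opS_neg_arg]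
    linear_combination (-s) * hsource x - (σ * opA V g x + γ * opS β g x) * hs
  have hi := avgIntegrable_of_sq hβ hL hV.continuous hg.contDiff.continuous hg.sq_integrable
  have hi' := avgIntegrable_of_sq hβ hL hV.continuous hn.contDiff.continuous hn.sq_integrable
  have havg := avg_add hi (hi'.const_mul (-s))
  rw [avg_const_mul, avg_neg_arg hper hsymm hg.periodic] at havg
  have hc' : (fun x => g x + -s * g (-x)) = fun _ => c := by
    funext x
    rw [← hc x]
    ring
  rw [hc', avg_const hβ hL hV.continuous] at havg
  -- At this point `havg` reads `c = (1 - s)` times the mean of `g`.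
  have hc0 : c = 0 := by
    rcases hmean with h | h
    · rw [havg, h]
      ring
    · rw [havg, h]
      ring
  have hx := hc x
  rw [hc0] at hx
  linear_combination (-s) * hx - g (-x) * hs

end Parity

/-! ### Parity and integrability along the hierarchy. -/

section Hierarchy

variable {V : ℝ → ℝ} {β γ L : ℝ} {f φ : ℕ → ℝ × ℝ → ℝ}

theorem SolvesPoissonHierarchy.f_parity (hβ : 0 < β) (hγ : 0 < γ) (hL : 0 < L)
    (hV : ContDiff ℝ 1 V) (hper : Function.Periodic V L) (hsymm : ∀ q, V q = V (-q))
    (hsol : SolvesPoissonHierarchy V β γ L f φ) (j : ℕ) (x : ℝ × ℝ) :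
    f j (-x) = (-1) ^ j * f j x := by
  induction j generalizing x with
  | zero => simp [hsol.f_zero]
  | succ j ih =>
    refine parity_of_source (σ := -1) hβ hγ (by norm_num) hL hV hper hsymm
      (hsol.f_admissible _) (by rw [← pow_mul, mul_comm, pow_mul]; simp) (fun x => ?_)
      (Or.inr (hsol.f_mean j)) x
    have h1 := hsol.f_succ j x
    have h2 := hsol.f_succ j (-x)
    simp only [genL0hat, aPlus, partialP_parity ih, ih, Prod.snd_neg] at h1 h2
    rw [pow_succ]
    linear_combination -h2 - (-1) ^ j * h1

theorem SolvesPoissonHierarchy.driftCoeff_eq_zero (hβ : 0 < β) (hγ : 0 < γ) (hL : 0 < L)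
    (hV : ContDiff ℝ 1 V) (hper : Function.Periodic V L) (hsymm : ∀ q, V q = V (-q))
    (hsol : SolvesPoissonHierarchy V β γ L f φ) {n : ℕ} (hn : Even n) :
    driftCoeff V β L f n = 0 :=
  avg_eq_zero_of_odd hper hsymm (fun q p => by rw [(hsol.f_admissible n).periodic]) fun x => by
    rw [hsol.f_parity hβ hγ hL hV hper hsymm, hn.neg_one_pow, Prod.snd_neg]
    ring

/-- Strong induction, because the mean of `φ_j` involves all earlier `φ`. The constant `V_j` in the
source is even, which is harmless for odd `j`; for even `j` it vanishes by the parity of `f_j`. -/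
theorem SolvesPoissonHierarchy.φ_parity (hβ : 0 < β) (hγ : 0 < γ) (hL : 0 < L)
    (hV : ContDiff ℝ 1 V) (hper : Function.Periodic V L) (hsymm : ∀ q, V q = V (-q))
    (hsol : SolvesPoissonHierarchy V β γ L f φ) (j : ℕ) (x : ℝ × ℝ) :
    φ j (-x) = (-1) ^ (j + 1) * φ j x := by
  induction j using Nat.strong_induction_on generalizing x with
  | _ j ih =>
  refine parity_of_source (σ := 1) hβ hγ (by norm_num) hL hV hper hsymm
    (hsol.φ_admissible _) (by rw [← pow_mul, mul_comm, pow_mul]; simp) (fun x => ?_) ?_ x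
  · cases j with
    | zero =>
      have h1 := hsol.φ_zero x
      have h2 := hsol.φ_zero (-x)
      simp only [genL0, Prod.snd_neg] at h1 h2
      linear_combination -h2 - h1
    | succ j =>
      have h1 := hsol.φ_succ j x
      have h2 := hsol.φ_succ j (-x)
      simp only [genL0, aMinus, partialP_parity (ih j j.lt_succ_self)] at h1 h2
      have hVj : driftCoeff V β L f (j + 1) = (-1) ^ j * driftCoeff V β L f (j + 1) := by
        rcases Nat.even_or_odd j with hj | hj
        · rw [hj.neg_one_pow, one_mul]
        · rw [hsol.driftCoeff_eq_zero hβ hγ hL hV hper hsymm hj.add_one, mul_zero]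
      simp only [pow_succ] at h2 ⊢
      linear_combination -h2 + (-1) ^ j * h1 + hVj
  · cases j with
    | zero => exact Or.inr hsol.φ_zero_mean
    | succ j =>
      -- For even `j` the target parity of `φ (j + 1)` is `s = 1` and its mean is irrelevant. For
      -- odd `j` it is `s = -1`, and the prescribed mean is zero because every product `f_r
      -- φ_(j+1-r)` is odd.
      rcases Nat.even_or_odd j with hj | hj
      · exact Or.inl (by simp [pow_succ, hj.neg_one_pow])
      · refine Or.inr ?_
        rw [hsol.φ_succ_mean, Finset.sum_eq_zero, neg_zero]
        intro r hr
        rw [Finset.mem_Icc] at hr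
        refine avg_eq_zero_of_odd hper hsymm (fun q p => by
          rw [(hsol.f_admissible r).periodic, (hsol.φ_admissible _).periodic]) fun x => ?_
        rw [hsol.f_parity hβ hγ hL hV hper hsymm, ih (j + 1 - r) (by omega)]
        have : ((-1 : ℝ)) ^ r * (-1) ^ (j + 1 - r + 1) = -1 := by
          rw [← pow_add, show r + (j + 1 - r + 1) = j + 1 + 1 by omega]
          simp [pow_succ, hj.neg_one_pow]
        linear_combination f r x * φ (j + 1 - r) x * this

/-- The source of the equation for `f n` is exactly `a⁺ w` with `w = f (n - 1) ∈ L²(ρ̄)`, the form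
required by the energy estimate. -/
theorem SolvesPoissonHierarchy.avgIntegrable_partialP_f_sq (hβ : 0 < β) (hγ : 0 < γ) (hL : 0 < L)
    (hV : ContDiff ℝ 1 V) (hper : Function.Periodic V L)
    (hsol : SolvesPoissonHierarchy V β γ L f φ) {n : ℕ} (hn : 1 ≤ n) :
    AvgIntegrable V β L (fun x => partialP (f n) x ^ 2) := by
  obtain ⟨j, rfl⟩ := Nat.exists_eq_add_of_le' hn
  refine (avgIntegrable_partialP_sq (σ := -1) hβ hγ hL hV hper (hsol.f_admissible _)
    ((hsol.f_admissible j).contDiff.of_le (by norm_num)) (hsol.f_admissible j).sq_integrable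
    fun x => ?_).1
  have := hsol.f_succ j x
  simp only [genL0hat] at this
  linear_combination -this

theorem SolvesPoissonHierarchy.avgIntegrable_momentum_mul_f_sq (hβ : 0 < β) (hγ : 0 < γ)
    (hL : 0 < L) (hV : ContDiff ℝ 1 V) (hper : Function.Periodic V L)
    (hsol : SolvesPoissonHierarchy V β γ L f φ) {n : ℕ} (hn : 1 ≤ n) :
    AvgIntegrable V β L (fun x => (x.2 * f n x) ^ 2) :=
  avgIntegrable_momentum_mul_sq hβ hL hV.continuous
    ((hsol.f_admissible n).contDiff.of_le (by norm_num)) (hsol.f_admissible n).sq_integrable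
    (hsol.avgIntegrable_partialP_f_sq hβ hγ hL hV hper hn)

end Hierarchy

end TiltedLangevin

/-! ### Vanishing of the coefficients. -/

theorem proposition1 (V : ℝ → ℝ) (β γ L : ℝ) (hβ : 0 < β) (hγ : 0 < γ) (hL : 0 < L)
    (hV : ContDiff ℝ 1 V) (hper : Function.Periodic V L) (hsymm : ∀ q, V q = V (-q))
    (f φ : ℕ → ℝ × ℝ → ℝ) (hsol : TiltedLangevin.SolvesPoissonHierarchy V β γ L f φ) :
    (∀ n : ℕ, 1 ≤ n → Even n →
      TiltedLangevin.AvgIntegrable V β L (fun x => f n x * x.2) ∧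
      TiltedLangevin.driftCoeff V β L f n = 0) ∧
    (∀ n l : ℕ, 1 ≤ n → n ≤ l → Odd l →
      (TiltedLangevin.AvgIntegrable V β L (fun x => x.2 * φ (l - n) x * f n x) ∧
        TiltedLangevin.sigmaCoeff V β L f φ n l = 0) ∧
      (TiltedLangevin.AvgIntegrable V β L
          (fun x => φ (l - n) x * TiltedLangevin.partialP (f n) x) ∧
        TiltedLangevin.xiCoeff V β L f φ n l = 0)) := by
  have cf : ∀ n, Continuous (f n) := fun n => (hsol.f_admissible n).contDiff.continuous
  have cφ : ∀ n, Continuous (φ n) := fun n => (hsol.φ_admissible n).contDiff.continuous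
  refine ⟨fun n hn hne => ⟨?_, hsol.driftCoeff_eq_zero hβ hγ hL hV hper hsymm hne⟩,
    fun n l hn hnl hl => ?_⟩
  · have := TiltedLangevin.avgIntegrable_of_sq hβ hL hV.continuous (by fun_prop)
      (hsol.avgIntegrable_momentum_mul_f_sq hβ hγ hL hV hper hn)
    simpa only [mul_comm] using this
  -- For odd `l` the product `φ_(l-n) f_n` is even; the extra `p` or `∂_p` makes both integrands
  -- odd.
  have hsign : ((-1 : ℝ)) ^ (l - n + 1) * (-1) ^ n = 1 := by
    rw [← pow_add, show l - n + 1 + n = l + 1 by omega]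
    exact hl.add_one.neg_one_pow
  have hfp := hsol.f_parity hβ hγ hL hV hper hsymm n
  have hφp := hsol.φ_parity hβ hγ hL hV hper hsymm (l - n)
  have hφ2 := (hsol.φ_admissible (l - n)).sq_integrable
  refine ⟨⟨?_, ?_⟩, ?_, ?_⟩
  · have := TiltedLangevin.avgIntegrable_mul_of_sq hβ hL hV.continuous (cφ (l - n))
      (by fun_prop) hφ2 (hsol.avgIntegrable_momentum_mul_f_sq hβ hγ hL hV hper hn)
    convert this using 2
    ring
  · refine TiltedLangevin.avg_eq_zero_of_odd hper hsymm (fun q p => by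
      rw [(hsol.φ_admissible _).periodic, (hsol.f_admissible _).periodic]) fun x => ?_
    rw [hφp, hfp, Prod.snd_neg]
    linear_combination (-(x.2 * φ (l - n) x * f n x)) * hsign
  · exact TiltedLangevin.avgIntegrable_mul_of_sq hβ hL hV.continuous (cφ (l - n))
      (TiltedLangevin.contDiff_partialP (hsol.f_admissible n).contDiff).continuous hφ2
      (hsol.avgIntegrable_partialP_f_sq hβ hγ hL hV hper hn)
  · rw [TiltedLangevin.xiCoeff, TiltedLangevin.avg_eq_zero_of_odd hper hsymm (fun q p => by
      rw [(hsol.φ_admissible _).periodic,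
        TiltedLangevin.partialP_add_period (hsol.f_admissible _).periodic]) fun x => ?_, mul_zero]
    rw [hφp, TiltedLangevin.partialP_parity hfp]
    linear_combination (-(φ (l - n) x * TiltedLangevin.partialP (f n) x)) * hsign
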